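/- Let $(W,S)$ be a Coxeter system with $S$ finite ($W$ may be infinite), with length function $\ell$. Let $\bar S$ be the set of classes of elements of $S$ under conjugacy in $W$, write $\bar s$ for the class of $s\in S$, and let $\mathbb Z[\bar S]$ be the free abelian group with basis $\bar S$. Let $\Gamma$ be a totally ordered abelian group and $\varphi:\bar S\to\Gamma$ a map. Let $\mathbb Z[\Gamma]=\bigoplus_{\gamma\in\Gamma}\mathbb Z e^\gamma$ be the group ring, and let $\mathcal H=\mathcal H(W,S,\varphi)$ be the Hecke algebra: the free $\mathbb Z[\Gamma]$-module with basis $(T_w)_{w\in W}$ and the associative bilinear multiplication determined by $T_wT_{w'}=T_{ww'}$ if $\ell(ww')=\ell(w)+\ell(w')$ and $(T_s-e^{\varphi(\bar s)})(T_s+e^{-\varphi(\bar s)})=0$ for $s\in S$. Let $h\mapsto\overline h$ be the additive map on $\mathcal H$ with $\overline{e^\gamma T_w}=e^{-\gamma}T_{w^{-1}}^{-1}$. For $w\in W$ let $C_w$ be the unique element of $\mathcal H$ such that $\overline{C_w}=C_w$ and $C_w\in T_w+\bigoplus_{y\in W}\mathbb Z[\Gamma_{<0}]\,T_y$, where $\mathbb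 Z[\Gamma_{<0}]=\bigoplus_{\gamma<0}\mathbb Z e^\gamma$; the family $(C_w)_{w\in W}$ is a $\mathbb Z[\Gamma]$-basis of $\mathcal H$. For $x,y\in W$ write $x\leftarrow_L y$ (respectively $x\leftarrow_R y$, respectively $x\leftarrow_{LR}y$) if there is $h\in\mathcal H$ such that the coefficient of $C_x$ in the expansion, in this basis, of $hC_y$ (respectively of $C_yh$, respectively of $hC_y$ or of $C_yh$) is non-zero. For $?\in\{L,R,LR\}$ let $\leqslant_?^\varphi$ be the transitive closure of $\leftarrow_?$ and let $\sim_?^\varphi$ be the equivalence relation on $W$ associated with the preorder $\leqslant_?^\varphi$: $x\sim_?^\varphi y$ if and only if $x\leqslant_?^\varphi y$ and $y\leqslant_?^\varphi x$. A subset $X$ of $\mathbb Z[\bar S]$ is called positive if $\mathbb Z[\bar S]=X\cup(-X)$, $X+X\subseteq X$, and $X\cap(-X)$ is a subgroup. For such an $X$ put $\Gamma_X=\mathbb Z[\bar S]/(X\cap(-X))$, totally ordered by: $\gamma\leqslant_X\gamma'$ if and only if some representative of $\gamma'-\gamma$ lies in $X$. Let $\varphi_X:\bar S\to\Gamma_X$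 be the canonical map, and put ${\sim_?^X}={\sim_?^{\varphi_X}}$. For $\omega\in\bar S$ let $\tau_\omega$ be the automorphism of $\mathbb Z[\bar S]$ with $\tau_\omega(\omega)=-\omega$ and $\tau_\omega(\omega')=\omega'$ for $\omega'\in\bar S$, $\omega'\ne\omega$, and put $\tau_\omega^*(X)=\tau_\omega^{-1}(X)$, which is again a positive subset. **Proposition.** For every $\omega\in\bar S$, every positive subset $X$ of $\mathbb Z[\bar S]$ and every $?\in\{L,R,LR\}$, the relations $\sim_?^X$ and $\sim_?^{\tau_\omega^*(X)}$ on $W$ coincide. -/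

import Mathlib

namespace CoxeterSystem

/-! ### An exchange property -/

/-- The permutation-type operator attached to a simple reflection: it conjugates the first
coordinate and records in the second one whether the first coordinate is that reflection. -/
noncomputable def exchangeStep {B W : Type*} [Group W] {M : CoxeterMatrix B}
    (cs : CoxeterSystem M W) (i : B) : Function.End (W × ZMod 2) :=
  open Classical in
  fun p => (cs.simple i * p.1 * cs.simple i, p.2 + if p.1 = cs.simple i then 1 else 0)

theorem exchangeStep_prod {B W : Type*} [Group W] [DecidableEq W] {M : CoxeterMatrix B}
    (cs : CoxeterSystem M W) (l : List B) (p : W × ZMod 2) :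
    (l.map cs.exchangeStep).prod p =
      (cs.wordProd l * p.1 * (cs.wordProd l)⁻¹, p.2 + ((cs.rightInvSeq l).count p.1 : ZMod 2)) := by
  induction l with
  | nil => simp [rightInvSeq]; rfl
  | cons i l ih =>
    rw [List.map_cons, List.prod_cons]
    change cs.exchangeStep i ((l.map cs.exchangeStep).prod p) = _
    rw [ih]
    simp only [exchangeStep, rightInvSeq, List.count_cons, wordProd_cons, Prod.mk.injEq]
    refine ⟨by simp [mul_assoc], ?_⟩
    have h : (cs.wordProd l * p.1 * (cs.wordProd l)⁻¹ = cs.simple i) ↔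
        ((cs.wordProd l)⁻¹ * cs.simple i * cs.wordProd l == p.1) = true := by
      rw [beq_iff_eq]
      constructor
      · intro h; rw [← h]; group
      · intro h; rw [← h]; group
    by_cases h' : cs.wordProd l * p.1 * (cs.wordProd l)⁻¹ = cs.simple i
    · rw [if_pos h', if_pos (h.1 h')]; push_cast; ring
    · rw [if_neg h', if_neg (fun e => h' (h.2 e))]; push_cast; ring

theorem map_alternatingWord_prod {B G : Type*} [Monoid G] (f : B → G) (i j : B) (m : ℕ) :
    ((alternatingWord i j (2 * m)).map f).prod = (f i * f j) ^ m := by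
  induction m with
  | zero => simp [alternatingWord]
  | succ m ih =>
    rw [show 2 * (m + 1) = 2 * m + 1 + 1 by ring, alternatingWord_succ, alternatingWord_succ,
      pow_succ, ← ih]
    simp

theorem count_leftInvSeq_alternatingWord {B W : Type*} [Group W] [DecidableEq W]
    {M : CoxeterMatrix B} (cs : CoxeterSystem M W) (i j : B) (t : W) :
    Even ((cs.leftInvSeq (alternatingWord i j (2 * M i j))).count t) := by
  set L := cs.leftInvSeq (alternatingWord i j (2 * M i j)) with hL
  have hlen : L.length = 2 * M i j := by simp [hL]
  have hper : L.drop (M i j) = L.take (M i j) := by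
    apply List.ext_getElem
    · simp [hlen]; omega
    · intro k h1 h2
      rw [List.getElem_drop, List.getElem_take]
      have hk : k < M i j := by simp [hlen] at h2; omega
      rw [getElem_leftInvSeq_alternatingWord cs i j (M i j) _ (by omega),
        getElem_leftInvSeq_alternatingWord cs i j (M i j) _ (by omega)]
      rw [alternatingWord_succ, alternatingWord_succ, wordProd_concat, wordProd_concat]
      congr 1
      unfold wordProd
      rw [map_alternatingWord_prod, map_alternatingWord_prod, pow_add]
      simp
  rw [← List.take_append_drop (M i j) L, hper, List.count_append]
  exact ⟨_, rfl⟩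

theorem exchangeStep_isLiftable {B W : Type*} [Group W] {M : CoxeterMatrix B}
    (cs : CoxeterSystem M W) : M.IsLiftable cs.exchangeStep := by
  classical
  intro i j
  rw [← map_alternatingWord_prod]
  funext p
  rw [exchangeStep_prod]
  have h1 : cs.wordProd (alternatingWord i j (2 * M i j)) = 1 := by
    unfold wordProd
    rw [map_alternatingWord_prod]; simp
  have h2 : Even ((cs.rightInvSeq (alternatingWord i j (2 * M i j))).count p.1) := by
    have := cs.leftInvSeq_reverse (alternatingWord i j (2 * M i j)).reverse
    rw [List.reverse_reverse] at this
    have h3 : cs.rightInvSeq (alternatingWord i j (2 * M i j)) =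
        (cs.leftInvSeq (alternatingWord i j (2 * M i j)).reverse).reverse := by
      rw [cs.leftInvSeq_reverse, List.reverse_reverse]
    have h4 : (alternatingWord i j (2 * M i j)).reverse = alternatingWord j i (2 * M j i) := by
      rw [M.symmetric j i]
      generalize M i j = m
      apply List.ext_getElem
      · simp
      · intro k h1 h2
        simp only [List.length_reverse, length_alternatingWord] at h1
        rw [List.getElem_reverse]
        simp only [length_alternatingWord]
        rw [getElem_alternatingWord _ _ _ _ (by omega), getElem_alternatingWord _ _ _ _ (by omega)]
        grind
    rw [h3, List.count_reverse, h4]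
    exact count_leftInvSeq_alternatingWord cs j i p.1
  rw [h1]
  obtain ⟨r, hr⟩ := h2
  have : ((r + r : ℕ) : ZMod 2) = 0 := by
    push_cast; exact CharTwo.add_self_eq_zero _
  rw [hr, this]
  simp
  rfl

theorem count_rightInvSeq_eq {B W : Type*} [Group W] [DecidableEq W] {M : CoxeterMatrix B}
    (cs : CoxeterSystem M W) {l l' : List B} (h : cs.wordProd l = cs.wordProd l') (t : W) :
    ((cs.rightInvSeq l).count t : ZMod 2) = (cs.rightInvSeq l').count t := by
  have key : ∀ l : List B, cs.lift ⟨_, cs.exchangeStep_isLiftable⟩ (cs.wordProd l) =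
      (l.map cs.exchangeStep).prod := by
    intro l
    unfold wordProd
    rw [map_list_prod, List.map_map]
    congr 2
    funext i
    simp
  have h2 : (l.map cs.exchangeStep).prod (t, 0) = (l'.map cs.exchangeStep).prod (t, 0) := by
    rw [← key, ← key, h]
  rw [exchangeStep_prod, exchangeStep_prod] at h2
  simpa using congrArg Prod.snd h2

theorem mem_rightInvSeq_of_isRightDescent {B W : Type*} [Group W] {M : CoxeterMatrix B}
    (cs : CoxeterSystem M W) (l : List B) (i : B) (h : cs.IsRightDescent (cs.wordProd l) i) :
    cs.simple i ∈ cs.rightInvSeq l := by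
  classical
  obtain ⟨l', hl', hw⟩ := cs.exists_isReduced (cs.wordProd l * cs.simple i)
  have hprod : cs.wordProd (l'.concat i) = cs.wordProd l := by
    rw [wordProd_concat, ← hw]; simp
  have hred : cs.IsReduced (l'.concat i) := by
    have h1 := cs.isRightDescent_iff.1 h
    unfold IsReduced
    rw [hprod, List.length_concat, ← h1, hw, hl'.eq]
  have hnd := hred.nodup_rightInvSeq
  have hmem : cs.simple i ∈ cs.rightInvSeq (l'.concat i) := by
    rw [rightInvSeq_concat]; simp
  have h3 := cs.count_rightInvSeq_eq hprod (cs.simple i)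
  rw [List.count_eq_one_of_mem hnd hmem] at h3
  by_contra hn
  rw [List.count_eq_zero_of_not_mem hn] at h3
  simp at h3

theorem exchange_right {B W : Type*} [Group W] {M : CoxeterMatrix B}
    (cs : CoxeterSystem M W) (w : W) (i j : B) (h1 : ¬ cs.IsRightDescent w j)
    (h2 : cs.IsRightDescent (cs.simple i * w) j) : cs.simple i * w = w * cs.simple j := by
  obtain ⟨l, hl, rfl⟩ := cs.exists_isReduced w
  rw [← wordProd_cons] at h2
  have h := cs.mem_rightInvSeq_of_isRightDescent _ _ h2
  rw [rightInvSeq, List.mem_cons] at h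
  rcases h with h | h
  · rw [h]; group
  · exact absurd (cs.isRightInversion_of_mem_rightInvSeq hl h).2 h1

theorem isRightDescent_simple_mul_iff {B W : Type*} [Group W] {M : CoxeterMatrix B}
    (cs : CoxeterSystem M W) (w : W) (i j : B) (h : cs.simple i * w ≠ w * cs.simple j) :
    cs.IsRightDescent (cs.simple i * w) j ↔ cs.IsRightDescent w j := by
  constructor
  · intro h2
    by_contra h1
    exact h (cs.exchange_right w i j h1 h2)
  · intro h2
    by_contra h1
    have := cs.exchange_right (cs.simple i * w) i j h1 (by simpa using h2)
    apply h
    rw [simple_mul_simple_cancel_left] at this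
    conv_rhs => rw [this]
    simp

theorem isLeftDescent_mul_simple_iff {B W : Type*} [Group W] {M : CoxeterMatrix B}
    (cs : CoxeterSystem M W) (w : W) (i j : B) (h : cs.simple i * w ≠ w * cs.simple j) :
    cs.IsLeftDescent (w * cs.simple j) i ↔ cs.IsLeftDescent w i := by
  rw [← isRightDescent_inv_iff, ← isRightDescent_inv_iff, mul_inv_rev, inv_simple]
  apply isRightDescent_simple_mul_iff
  intro h'
  apply h
  have := congrArg (·⁻¹) h'
  simpa using this.symm

end CoxeterSystem

namespace CoxeterSystem

/-! ### Conjugacy classes of simple reflections -/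

/-- Two indices are equivalent when the simple reflections are conjugate in `W`. -/
def simpleConj {B W : Type*} [Group W] {M : CoxeterMatrix B} (cs : CoxeterSystem M W) :
    Setoid B where
  r i j := IsConj (cs.simple i) (cs.simple j)
  iseqv := ⟨fun _ => IsConj.refl _, fun h => h.symm, fun h h' => h.trans h'⟩

/-- The set of `W`-conjugacy classes of simple reflections. -/
def SBar {B W : Type*} [Group W] {M : CoxeterMatrix B} (cs : CoxeterSystem M W) : Type _ :=
  Quotient cs.simpleConj

/-- The class of a simple reflection. -/
def toSBar {B W : Type*} [Group W] {M : CoxeterMatrix B} (cs : CoxeterSystem M W) (i : B) :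
    cs.SBar :=
  Quotient.mk cs.simpleConj i

/-! ### The Hecke algebra with unequal parameters -/

/-- The underlying module of the Hecke algebra with parameter `φ`: the free module over
the group ring `ℤ[Γ]` on the set `W`. -/
def HeckeAlgebra {B W Γ : Type*} [Group W] {M : CoxeterMatrix B} (cs : CoxeterSystem M W)
    [AddCommGroup Γ] (_φ : cs.SBar → Γ) : Type _ :=
  W →₀ AddMonoidAlgebra ℤ Γ

namespace HeckeAlgebra

noncomputable section

variable {B W Γ : Type*} [Group W] {M : CoxeterMatrix B} {cs : CoxeterSystem M W}
  [AddCommGroup Γ] {φ : cs.SBar → Γ}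

instance : AddCommGroup (HeckeAlgebra cs φ) :=
  inferInstanceAs (AddCommGroup (W →₀ AddMonoidAlgebra ℤ Γ))

instance : Module (AddMonoidAlgebra ℤ Γ) (HeckeAlgebra cs φ) :=
  inferInstanceAs (Module (AddMonoidAlgebra ℤ Γ) (W →₀ AddMonoidAlgebra ℤ Γ))

variable (cs φ) in
/-- The standard basis `(T_w)`. -/
def basis : Module.Basis W (AddMonoidAlgebra ℤ Γ) (HeckeAlgebra cs φ) :=
  Module.Basis.ofRepr (LinearEquiv.refl _ (W →₀ AddMonoidAlgebra ℤ Γ))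

variable (cs φ) in
/-- The standard basis element `T_w`. -/
def T (w : W) : HeckeAlgebra cs φ := basis cs φ w

variable (cs φ) in
/-- The scalar `e^{φ(s)} - e^{-φ(s)}`. -/
def xi (i : B) : AddMonoidAlgebra ℤ Γ :=
  AddMonoidAlgebra.single (φ (cs.toSBar i)) 1 - AddMonoidAlgebra.single (-φ (cs.toSBar i)) 1

open Classical in
variable (cs φ) in
/-- Left multiplication by `T_s`. -/
def leftOp (i : B) : Module.End (AddMonoidAlgebra ℤ Γ) (HeckeAlgebra cs φ) :=
  (basis cs φ).constr (AddMonoidAlgebra ℤ Γ) fun w =>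
    T cs φ (cs.simple i * w) + if cs.IsLeftDescent w i then xi cs φ i • T cs φ w else 0

open Classical in
variable (cs φ) in
/-- Right multiplication by `T_s`. -/
def rightOp (i : B) : Module.End (AddMonoidAlgebra ℤ Γ) (HeckeAlgebra cs φ) :=
  (basis cs φ).constr (AddMonoidAlgebra ℤ Γ) fun w =>
    T cs φ (w * cs.simple i) + if cs.IsRightDescent w i then xi cs φ i • T cs φ w else 0

theorem leftOp_T (i : B) (w : W) [Decidable (cs.IsLeftDescent w i)] :
    leftOp cs φ i (T cs φ w) =
    T cs φ (cs.simple i * w) + if cs.IsLeftDescent w i then xi cs φ i • T cs φ w else 0 := by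
  rw [leftOp, T, Module.Basis.constr_basis]
  congr

theorem rightOp_T (i : B) (w : W) [Decidable (cs.IsRightDescent w i)] :
    rightOp cs φ i (T cs φ w) =
    T cs φ (w * cs.simple i) + if cs.IsRightDescent w i then xi cs φ i • T cs φ w else 0 := by
  rw [rightOp, T, Module.Basis.constr_basis]
  congr

theorem leftOp_comm_rightOp (i j : B) :
    leftOp cs φ i * rightOp cs φ j = rightOp cs φ j * leftOp cs φ i := by
  classical
  refine (basis cs φ).ext fun w => ?_
  change leftOp cs φ i (rightOp cs φ j (T cs φ w)) = rightOp cs φ j (leftOp cs φ i (T cs φ w))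
  rw [rightOp_T, leftOp_T, map_add, map_add, leftOp_T, rightOp_T, mul_assoc]
  by_cases h : cs.simple i * w = w * cs.simple j
  · have hx : xi cs φ i = xi cs φ j := by
      have : cs.toSBar i = cs.toSBar j := by
        refine Quotient.sound (s := cs.simpleConj) (IsConj.symm ?_)
        refine isConj_iff.2 ⟨w, ?_⟩
        rw [← h]; group
      rw [xi, xi, this]
    have hw : cs.simple i * (w * cs.simple j) = w := by rw [← h]; simp
    have h1 : cs.IsLeftDescent (w * cs.simple j) i ↔ cs.IsRightDescent (cs.simple i * w) j := by
      rw [IsLeftDescent, IsRightDescent, hw, mul_assoc, hw, h]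
    have h2 : cs.IsLeftDescent w i ↔ cs.IsRightDescent w j := by
      rw [IsLeftDescent, IsRightDescent, h]
    simp only [h1, h2, h, hx]
    split_ifs <;> simp only [map_smul, map_zero, leftOp_T, rightOp_T, h2, h, hx]
  · have h1 := cs.isLeftDescent_mul_simple_iff w i j h
    have h2 := cs.isRightDescent_simple_mul_iff w i j h
    simp only [h1, h2]
    split_ifs <;> simp only [map_smul, map_zero, leftOp_T, rightOp_T] <;>
      simp [*, smul_smul, mul_comm]; abel

variable (cs) in
/-- A chosen reduced expression of `w`. -/
def redWord (w : W) : List B := (cs.exists_isReduced w).choose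

theorem redWord_isReduced (w : W) : cs.IsReduced (redWord cs w) :=
  (cs.exists_isReduced w).choose_spec.1

theorem wordProd_redWord (w : W) : cs.wordProd (redWord cs w) = w :=
  (cs.exists_isReduced w).choose_spec.2.symm

variable (cs φ) in
/-- The bilinear multiplication: `T_w` acts on the left through the operators of a
reduced expression of `w`. -/
def mulLin : HeckeAlgebra cs φ →ₗ[AddMonoidAlgebra ℤ Γ]
    Module.End (AddMonoidAlgebra ℤ Γ) (HeckeAlgebra cs φ) :=
  (basis cs φ).constr (AddMonoidAlgebra ℤ Γ) fun w => ((redWord cs w).map (leftOp cs φ)).prod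

theorem mulLin_T (w : W) :
    mulLin cs φ (T cs φ w) = ((redWord cs w).map (leftOp cs φ)).prod := by
  rw [mulLin, T, Module.Basis.constr_basis]

theorem leftOp_prod_T_one (l : List B) (hl : cs.IsReduced l) :
    (l.map (leftOp cs φ)).prod (T cs φ 1) = T cs φ (cs.wordProd l) := by
  classical
  induction l with
  | nil => simp
  | cons i l ih =>
    have hl' : cs.IsReduced l := by simpa using hl.drop 1
    rw [List.map_cons, List.prod_cons, Module.End.mul_apply, ih hl', leftOp_T, if_neg, add_zero,
      wordProd_cons]
    rw [IsLeftDescent, ← wordProd_cons, hl.eq, hl'.eq]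
    simp

theorem rightOp_prod_T_one (l : List B) (hl : cs.IsReduced l) :
    (l.reverse.map (rightOp cs φ)).prod (T cs φ 1) = T cs φ (cs.wordProd l) := by
  classical
  induction l using List.reverseRecOn with
  | nil => simp
  | append_singleton l i ih =>
    have hl' : cs.IsReduced l := by simpa using hl.take l.length
    rw [List.reverse_append, List.reverse_singleton, List.singleton_append, List.map_cons,
      List.prod_cons, Module.End.mul_apply, ih hl', rightOp_T, if_neg, add_zero,
      ← wordProd_concat, List.concat_eq_append]
    rw [IsRightDescent, ← wordProd_concat, List.concat_eq_append, hl.eq, hl'.eq]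
    simp

theorem mulLin_T_apply_one (a : HeckeAlgebra cs φ) : mulLin cs φ a (T cs φ 1) = a := by
  have : (LinearMap.applyₗ (T cs φ 1)).comp (mulLin cs φ) = LinearMap.id := by
    refine (basis cs φ).ext fun w => ?_
    change mulLin cs φ (T cs φ w) (T cs φ 1) = T cs φ w
    rw [mulLin_T, leftOp_prod_T_one _ (redWord_isReduced w), wordProd_redWord]
  exact LinearMap.congr_fun this a

theorem eq_of_commute {f g : Module.End (AddMonoidAlgebra ℤ Γ) (HeckeAlgebra cs φ)}
    (hf : ∀ j, Commute f (rightOp cs φ j)) (hg : ∀ j, Commute g (rightOp cs φ j))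
    (h : f (T cs φ 1) = g (T cs φ 1)) : f = g := by
  have key : ∀ k : Module.End (AddMonoidAlgebra ℤ Γ) (HeckeAlgebra cs φ),
      (∀ j, Commute k (rightOp cs φ j)) → ∀ w, k (T cs φ w) =
        ((redWord cs w).reverse.map (rightOp cs φ)).prod (k (T cs φ 1)) := by
    intro k hk w
    have hc : Commute k ((redWord cs w).reverse.map (rightOp cs φ)).prod := by
      apply Commute.list_prod_right
      intro x hx
      obtain ⟨j, -, rfl⟩ := List.mem_map.1 hx
      exact hk j
    conv_lhs => rw [← wordProd_redWord (cs := cs) w,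
      ← rightOp_prod_T_one _ (redWord_isReduced w), ← Module.End.mul_apply, hc.eq]
    rfl
  refine (basis cs φ).ext fun w => ?_
  change f (T cs φ w) = g (T cs φ w)
  rw [key f hf, key g hg, h]

theorem mulLin_commute (a : HeckeAlgebra cs φ) (j : B) :
    Commute (mulLin cs φ a) (rightOp cs φ j) := by
  have : (LinearMap.mulRight (AddMonoidAlgebra ℤ Γ) (rightOp cs φ j)).comp (mulLin cs φ) =
      (LinearMap.mulLeft (AddMonoidAlgebra ℤ Γ) (rightOp cs φ j)).comp (mulLin cs φ) := by
    refine (basis cs φ).ext fun w => ?_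
    change mulLin cs φ (T cs φ w) * rightOp cs φ j = rightOp cs φ j * mulLin cs φ (T cs φ w)
    rw [mulLin_T]
    apply Commute.list_prod_left
    intro x hx
    obtain ⟨i, -, rfl⟩ := List.mem_map.1 hx
    exact leftOp_comm_rightOp i j
  exact LinearMap.congr_fun this a

theorem mulLin_mulLin (a b : HeckeAlgebra cs φ) :
    mulLin cs φ (mulLin cs φ a b) = mulLin cs φ a * mulLin cs φ b :=
  eq_of_commute (mulLin_commute _)
    (fun j => (mulLin_commute a j).mul_left (mulLin_commute b j)) (by
      rw [mulLin_T_apply_one, Module.End.mul_apply, mulLin_T_apply_one])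

theorem mulLin_T_one : mulLin cs φ (T cs φ 1) = 1 :=
  eq_of_commute (mulLin_commute _) (fun j => Commute.one_left _) (by
    rw [mulLin_T_apply_one]; rfl)

instance : Mul (HeckeAlgebra cs φ) := ⟨fun a b => mulLin cs φ a b⟩

instance : One (HeckeAlgebra cs φ) := ⟨T cs φ 1⟩

theorem mul_def (a b : HeckeAlgebra cs φ) : a * b = mulLin cs φ a b := rfl

theorem one_def : (1 : HeckeAlgebra cs φ) = T cs φ 1 := rfl

instance : Ring (HeckeAlgebra cs φ) where
  __ := (inferInstance : AddCommGroup (HeckeAlgebra cs φ))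
  left_distrib a b c := by simp only [mul_def, map_add]
  right_distrib a b c := by simp only [mul_def, map_add, LinearMap.add_apply]
  zero_mul a := by simp only [mul_def, map_zero, LinearMap.zero_apply]
  mul_zero a := by simp only [mul_def, map_zero]
  mul_assoc a b c := by simp only [mul_def, mulLin_mulLin, Module.End.mul_apply]
  one_mul a := by simp only [mul_def, one_def, mulLin_T_one, Module.End.one_apply]
  mul_one a := by simp only [mul_def, one_def, mulLin_T_apply_one]

instance : Algebra (AddMonoidAlgebra ℤ Γ) (HeckeAlgebra cs φ) :=
  Algebra.ofModule
    (fun r a b => by simp only [mul_def, map_smul, LinearMap.smul_apply])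
    (fun r a b => by simp only [mul_def, map_smul])

theorem mulLin_T_simple (i : B) : mulLin cs φ (T cs φ (cs.simple i)) = leftOp cs φ i :=
  eq_of_commute (mulLin_commute _) (leftOp_comm_rightOp i) (by
    classical
    rw [mulLin_T_apply_one, leftOp_T, if_neg (cs.not_isLeftDescent_one i), mul_one, add_zero])

theorem T_simple_mul_of_not_descent {i : B} {w : W} (h : ¬ cs.IsLeftDescent w i) :
    T cs φ (cs.simple i) * T cs φ w = T cs φ (cs.simple i * w) := by
  classical
  rw [mul_def, mulLin_T_simple, leftOp_T, if_neg h, add_zero]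

theorem T_simple_mul_of_descent {i : B} {w : W} (h : cs.IsLeftDescent w i) :
    T cs φ (cs.simple i) * T cs φ w = T cs φ (cs.simple i * w) + xi cs φ i • T cs φ w := by
  classical
  rw [mul_def, mulLin_T_simple, leftOp_T, if_pos h]

/-- First defining rule of the multiplication. -/
theorem T_mul_T (w w' : W) (h : cs.length (w * w') = cs.length w + cs.length w') :
    T cs φ w * T cs φ w' = T cs φ (w * w') := by
  obtain ⟨l, hl, rfl⟩ := cs.exists_isReduced w
  induction l with
  | nil => simp [← one_def]
  | cons i l ih =>
    have hl' : cs.IsReduced l := by simpa using hl.drop 1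
    have e := hl.eq
    have e' := hl'.eq
    rw [List.length_cons] at e
    rw [wordProd_cons] at h e ⊢
    have b1 := cs.length_mul_le (cs.wordProd l) w'
    have b2 := cs.length_mul_le (cs.simple i) (cs.wordProd l * w')
    rw [cs.length_simple, ← mul_assoc] at b2
    have n1 : ¬ cs.IsLeftDescent (cs.wordProd l) i := by rw [IsLeftDescent]; omega
    have n2 : ¬ cs.IsLeftDescent (cs.wordProd l * w') i := by
      rw [IsLeftDescent, ← mul_assoc]; omega
    rw [← T_simple_mul_of_not_descent n1, mul_assoc (T cs φ _), ih hl' (by omega),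
      T_simple_mul_of_not_descent n2, mul_assoc]

theorem T_simple_sq (i : B) : T cs φ (cs.simple i) * T cs φ (cs.simple i) =
    1 + xi cs φ i • T cs φ (cs.simple i) := by
  rw [T_simple_mul_of_descent, one_def]
  · simp
  · simp [IsLeftDescent]

/-- Second defining rule of the multiplication. -/
theorem quadratic (i : B) :
    (T cs φ (cs.simple i) - algebraMap _ _ (AddMonoidAlgebra.single (φ (cs.toSBar i)) (1 : ℤ))) *
    (T cs φ (cs.simple i) + algebraMap _ _ (AddMonoidAlgebra.single (-φ (cs.toSBar i)) (1 : ℤ)))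
      = 0 := by
  have h : algebraMap (AddMonoidAlgebra ℤ Γ) (HeckeAlgebra cs φ)
        (AddMonoidAlgebra.single (φ (cs.toSBar i)) (1 : ℤ)) *
      algebraMap _ _ (AddMonoidAlgebra.single (-φ (cs.toSBar i)) (1 : ℤ)) = 1 := by
    rw [← map_mul, AddMonoidAlgebra.single_mul_single, add_neg_cancel, mul_one,
      ← AddMonoidAlgebra.one_def, map_one]
  rw [sub_mul, mul_add, mul_add, h, T_simple_sq, Algebra.smul_def, xi, map_sub, sub_mul,
    ← Algebra.commutes (AddMonoidAlgebra.single (-φ (cs.toSBar i)) (1 : ℤ))]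
  abel

end

end HeckeAlgebra

end CoxeterSystem

namespace CoxeterSystem

namespace HeckeAlgebra

noncomputable section

variable {B W Γ : Type*} [Group W] {M : CoxeterMatrix B} {cs : CoxeterSystem M W}
  [AddCommGroup Γ] {φ : cs.SBar → Γ}

/-! ### The bar involution -/

theorem T_simple_mul_inv (i : B) :
    T cs φ (cs.simple i) * (T cs φ (cs.simple i) - algebraMap _ _ (xi cs φ i)) = 1 := by
  rw [mul_sub, T_simple_sq, Algebra.smul_def, Algebra.commutes, add_sub_cancel_right]

theorem T_simple_inv_mul (i : B) :
    (T cs φ (cs.simple i) - algebraMap _ _ (xi cs φ i)) * T cs φ (cs.simple i) = 1 := by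
  rw [sub_mul, T_simple_sq, Algebra.smul_def, add_sub_cancel_right]

theorem isUnit_T_simple (i : B) : IsUnit (T cs φ (cs.simple i)) :=
  ⟨⟨_, _, T_simple_mul_inv i, T_simple_inv_mul i⟩, rfl⟩

theorem inverse_T_simple (i : B) :
    Ring.inverse (T cs φ (cs.simple i)) = T cs φ (cs.simple i) - algebraMap _ _ (xi cs φ i) :=
  Ring.inverse_unit (⟨_, _, T_simple_mul_inv i, T_simple_inv_mul i⟩ : (HeckeAlgebra cs φ)ˣ)

theorem isUnit_T (w : W) : IsUnit (T cs φ w) := by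
  obtain ⟨l, hl, rfl⟩ := cs.exists_isReduced w
  induction l with
  | nil => rw [wordProd_nil, ← one_def]; exact isUnit_one
  | cons i l ih =>
    have hl' : cs.IsReduced l := by simpa using hl.drop 1
    rw [wordProd_cons, ← T_simple_mul_of_not_descent]
    · exact (isUnit_T_simple i).mul (ih hl')
    · rw [IsLeftDescent, ← wordProd_cons, hl.eq, hl'.eq]
      simp

variable (Γ) in
/-- The involution `e^γ ↦ e^{-γ}` of the group ring. -/
def barCoeff : AddMonoidAlgebra ℤ Γ →+* AddMonoidAlgebra ℤ Γ :=
  AddMonoidAlgebra.mapDomainRingHom ℤ (negAddMonoidHom : Γ →+ Γ)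

theorem barCoeff_single (γ : Γ) (n : ℤ) :
    barCoeff Γ (AddMonoidAlgebra.single γ n) = AddMonoidAlgebra.single (-γ) n := by
  simp [barCoeff]

theorem coeff_barCoeff (a : AddMonoidAlgebra ℤ Γ) (γ : Γ) :
    (barCoeff Γ a).coeff γ = a.coeff (-γ) := by
  induction a using AddMonoidAlgebra.induction_linear with
  | zero => simp
  | add a b ha hb => simp [ha, hb]
  | single δ n =>
    classical
    rw [barCoeff_single]
    simp [Finsupp.single_apply, neg_eq_iff_eq_neg]

variable (cs φ) in
/-- The bar involution: the antilinear map sending `T_w` to `(T_{w⁻¹})⁻¹`. -/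
def bar : HeckeAlgebra cs φ →ₛₗ[barCoeff Γ] HeckeAlgebra cs φ where
  toFun h := ((basis cs φ).repr h).sum fun w a => barCoeff Γ a • Ring.inverse (T cs φ w⁻¹)
  map_add' a b := by
    rw [map_add]
    exact Finsupp.sum_add_index' (by simp) (by simp [add_smul])
  map_smul' r a := by
    rw [map_smul, Finsupp.sum_smul_index (by simp), Finsupp.smul_sum]
    simp [mul_smul]

theorem bar_T (w : W) : bar cs φ (T cs φ w) = Ring.inverse (T cs φ w⁻¹) := by
  change ((basis cs φ).repr (T cs φ w)).sum
    (fun w a => barCoeff Γ a • Ring.inverse (T cs φ w⁻¹)) = _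
  rw [T, Module.Basis.repr_self, Finsupp.sum_single_index (by simp)]
  simp

theorem bar_one : bar cs φ 1 = 1 := by
  rw [one_def, bar_T, inv_one, ← one_def, Ring.inverse_one]

theorem bar_T_simple_mul_T_of_not_descent {i : B} {w : W} (h : ¬ cs.IsLeftDescent w i) :
    bar cs φ (T cs φ (cs.simple i * w)) =
      (T cs φ (cs.simple i) - algebraMap _ _ (xi cs φ i)) * bar cs φ (T cs φ w) := by
  rw [bar_T, bar_T, mul_inv_rev, inv_simple, ← T_mul_T w⁻¹ (cs.simple i), ← inverse_T_simple]
  · obtain ⟨u, hu⟩ := isUnit_T (φ := φ) w⁻¹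
    obtain ⟨v, hv⟩ := isUnit_T_simple (φ := φ) i
    rw [← hu, ← hv, ← Units.val_mul, Ring.inverse_unit, Ring.inverse_unit, Ring.inverse_unit,
      mul_inv_rev, Units.val_mul]
  · rw [cs.length_simple, cs.length_inv, ← cs.not_isLeftDescent_iff.1 h, ← cs.length_inv,
      mul_inv_rev, inv_inv, inv_simple]

theorem barCoeff_xi (i : B) : barCoeff Γ (xi cs φ i) = - xi cs φ i := by
  rw [xi, map_sub, barCoeff_single, barCoeff_single, neg_neg, neg_sub]

theorem bar_T_simple_mul (i : B) (h : HeckeAlgebra cs φ) :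
    bar cs φ (T cs φ (cs.simple i) * h) =
      (T cs φ (cs.simple i) - algebraMap _ _ (xi cs φ i)) * bar cs φ h := by
  have key : (bar cs φ).comp (LinearMap.mulLeft (AddMonoidAlgebra ℤ Γ) (T cs φ (cs.simple i))) =
      (LinearMap.mulLeft (AddMonoidAlgebra ℤ Γ)
        (T cs φ (cs.simple i) - algebraMap _ _ (xi cs φ i))).comp (bar cs φ) := by
    refine (basis cs φ).ext fun w => ?_
    change bar cs φ (T cs φ (cs.simple i) * T cs φ w) = _ * bar cs φ (T cs φ w)
    by_cases hd : cs.IsLeftDescent w i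
    · have hd' : ¬ cs.IsLeftDescent (cs.simple i * w) i :=
        cs.isLeftDescent_iff_not_isLeftDescent_mul.1 hd
      have e := bar_T_simple_mul_T_of_not_descent (φ := φ) hd'
      rw [simple_mul_simple_cancel_left] at e
      rw [T_simple_mul_of_descent hd, map_add, LinearMap.map_smulₛₗ, barCoeff_xi, e, ← mul_assoc,
        Algebra.smul_def, ← mul_assoc]
      set t := T cs φ (cs.simple i)
      set x := algebraMap (AddMonoidAlgebra ℤ Γ) (HeckeAlgebra cs φ) (xi cs φ i) with hx
      have h1 : t * t = 1 + x * t := by rw [T_simple_sq, Algebra.smul_def]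
      have h2 : t * x = x * t := (Algebra.commutes _ _).symm
      rw [map_neg, ← hx]
      conv_lhs => enter [1]; rw [← one_mul (bar cs φ (T cs φ (cs.simple i * w)))]
      rw [← add_mul]
      congr 1
      rw [sub_mul, mul_sub, mul_sub, h1, h2]
      noncomm_ring
    · rw [T_simple_mul_of_not_descent hd, bar_T_simple_mul_T_of_not_descent hd]
  exact LinearMap.congr_fun key h

/-! ### The length filtration -/

variable (cs φ) in
/-- The span of the `T_y` with `y` of length smaller than `n`. -/
def low (n : ℕ) : Submodule (AddMonoidAlgebra ℤ Γ) (HeckeAlgebra cs φ) where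
  carrier := {h | ∀ y, n ≤ cs.length y → (basis cs φ).repr h y = 0}
  add_mem' ha hb y hy := by simp [ha y hy, hb y hy]
  zero_mem' y _ := by simp
  smul_mem' r a ha y hy := by simp [ha y hy]

theorem repr_T [DecidableEq W] (w y : W) :
    (basis cs φ).repr (T cs φ w) y = if w = y then 1 else 0 := by
  rw [T, Module.Basis.repr_self, Finsupp.single_apply]

theorem T_mem_low {w : W} {n : ℕ} (h : cs.length w < n) : T cs φ w ∈ low cs φ n := by
  classical
  intro y hy
  rw [repr_T, if_neg]
  rintro rfl
  omega

theorem low_mono {m n : ℕ} (h : m ≤ n) : low cs φ m ≤ low cs φ n :=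
  fun _ ha y hy => ha y (h.trans hy)

theorem mem_of_T_mem {n : ℕ} {h : HeckeAlgebra cs φ} (hh : h ∈ low cs φ n)
    {N : Submodule (AddMonoidAlgebra ℤ Γ) (HeckeAlgebra cs φ)}
    (f : Module.End (AddMonoidAlgebra ℤ Γ) (HeckeAlgebra cs φ))
    (hN : ∀ y, cs.length y < n → f (T cs φ y) ∈ N) : f h ∈ N := by
  rw [← (basis cs φ).linearCombination_repr h, Finsupp.linearCombination_apply, Finsupp.sum,
    map_sum]
  refine Submodule.sum_mem _ fun y hy => ?_
  rw [map_smul]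
  refine Submodule.smul_mem _ _ (hN y ?_)
  by_contra hlt
  exact Finsupp.mem_support_iff.1 hy (hh y (by omega))

theorem T_simple_mul_mem_low {n : ℕ} (i : B) {h : HeckeAlgebra cs φ} (hh : h ∈ low cs φ n) :
    T cs φ (cs.simple i) * h ∈ low cs φ (n + 1) := by
  refine mem_of_T_mem hh (LinearMap.mulLeft (AddMonoidAlgebra ℤ Γ) (T cs φ (cs.simple i))) ?_
  intro y hy
  rw [LinearMap.mulLeft_apply]
  by_cases hd : cs.IsLeftDescent y i
  · rw [T_simple_mul_of_descent hd]
    have : cs.length (cs.simple i * y) < cs.length y := hd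
    exact Submodule.add_mem _ (T_mem_low (by omega)) (Submodule.smul_mem _ _ (T_mem_low (by omega)))
  · rw [T_simple_mul_of_not_descent hd]
    have := cs.not_isLeftDescent_iff.1 hd
    exact T_mem_low (by omega)

theorem bar_T_sub_mem_low (w : W) :
    bar cs φ (T cs φ w) - T cs φ w ∈ low cs φ (cs.length w) := by
  obtain ⟨l, hl, rfl⟩ := cs.exists_isReduced w
  induction l with
  | nil => rw [wordProd_nil, ← one_def, bar_one, sub_self]; exact Submodule.zero_mem _
  | cons i l ih =>
    have hl' : cs.IsReduced l := by simpa using hl.drop 1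
    have hd : ¬ cs.IsLeftDescent (cs.wordProd l) i := by
      rw [IsLeftDescent, ← wordProd_cons, hl.eq, hl'.eq]
      simp
    have hlen := cs.not_isLeftDescent_iff.1 hd
    rw [wordProd_cons, ← T_simple_mul_of_not_descent hd, bar_T_simple_mul, sub_mul, hlen]
    set t := T cs φ (cs.wordProd l)
    have hb : bar cs φ t ∈ low cs φ (cs.length (cs.wordProd l) + 1) := by
      rw [← sub_add_cancel (bar cs φ t) t]
      exact Submodule.add_mem _ (low_mono (by omega) (ih hl')) (T_mem_low (by omega))
    have : T cs φ (cs.simple i) * bar cs φ t - algebraMap _ _ (xi cs φ i) * bar cs φ t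
        - T cs φ (cs.simple i) * t =
        T cs φ (cs.simple i) * (bar cs φ t - t) - xi cs φ i • bar cs φ t := by
      rw [Algebra.smul_def, mul_sub]; abel
    rw [this]
    exact Submodule.sub_mem _ (T_simple_mul_mem_low i (ih hl')) (Submodule.smul_mem _ _ hb)

/-! ### The Kazhdan-Lusztig basis -/

variable [LinearOrder Γ]

variable (Γ) in
/-- The subgroup `ℤ[Γ_{<0}]` of the group ring. -/
def negCoeff : AddSubgroup (AddMonoidAlgebra ℤ Γ) where
  carrier := {a | ∀ γ, a.coeff γ ≠ 0 → γ < 0}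
  add_mem' {a b} ha hb γ h := by
    by_cases h' : a.coeff γ = 0
    · exact hb γ (by simpa [h'] using h)
    · exact ha γ h'
  zero_mem' γ h := by simp at h
  neg_mem' {a} ha γ h := ha γ (by simpa using h)

variable (cs φ) in
/-- The subgroup `⨁_w ℤ[Γ_{<0}] T_w` of the Hecke algebra. -/
def negPart : AddSubgroup (HeckeAlgebra cs φ) where
  carrier := {h | ∀ w, (basis cs φ).repr h w ∈ negCoeff Γ}
  add_mem' ha hb w := by simpa using add_mem (ha w) (hb w)
  zero_mem' w := by simp [zero_mem]
  neg_mem' ha w := by simpa using ha w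

/-- The characterization of the Kazhdan-Lusztig element `C_w`: it is invariant under the bar
involution and congruent to `T_w` modulo `⨁_y ℤ[Γ_{<0}] T_y`. -/
def IsKL (w : W) (C : HeckeAlgebra cs φ) : Prop :=
  bar cs φ C = C ∧ C - T cs φ w ∈ negPart cs φ

variable [IsOrderedAddMonoid Γ]

theorem exists_bar_invariant_approx (a : AddMonoidAlgebra ℤ Γ) :
    ∃ s, barCoeff Γ s = s ∧ a - s ∈ negCoeff Γ := by
  induction a using AddMonoidAlgebra.induction_linear with
  | zero => exact ⟨0, by simp, by simp [zero_mem]⟩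
  | add a b ha hb =>
    obtain ⟨s, hs, has⟩ := ha
    obtain ⟨t, ht, hbt⟩ := hb
    exact ⟨s + t, by rw [map_add, hs, ht], by rw [add_sub_add_comm]; exact add_mem has hbt⟩
  | single δ n =>
    classical
    rcases lt_trichotomy δ 0 with h | rfl | h
    · refine ⟨0, by simp, ?_⟩
      intro γ hγ
      rw [sub_zero, AddMonoidAlgebra.coeff_single, Finsupp.single_apply] at hγ
      by_cases e : δ = γ
      · exact e ▸ h
      · simp [e] at hγ
    · exact ⟨.single 0 n, by rw [barCoeff_single, neg_zero], by simp [zero_mem]⟩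
    · refine ⟨.single δ n + .single (-δ) n, ?_, ?_⟩
      · rw [map_add, barCoeff_single, barCoeff_single, neg_neg, add_comm]
      · rw [sub_add_cancel_left]
        refine neg_mem ?_
        intro γ hγ
        rw [AddMonoidAlgebra.coeff_single, Finsupp.single_apply] at hγ
        by_cases e : -δ = γ
        · rw [← e]; simpa using h
        · simp [e] at hγ

theorem eq_zero_of_bar_invariant_of_neg {a : AddMonoidAlgebra ℤ Γ} (h : barCoeff Γ a = a)
    (ha : a ∈ negCoeff Γ) : a = 0 := by
  ext γ
  by_contra hne
  have h1 : γ < 0 := ha γ hne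
  have h2 : -γ < 0 := ha (-γ) (by rw [← coeff_barCoeff, h]; exact hne)
  exact lt_asymm h1 (by simpa using h2)

theorem eq_zero_of_bar_eq_of_mem_negPart {h : HeckeAlgebra cs φ} (hb : bar cs φ h = h)
    (hn : h ∈ negPart cs φ) : h = 0 := by
  classical
  by_contra h0
  have hs : ((basis cs φ).repr h).support.Nonempty := by
    rw [Finsupp.support_nonempty_iff]
    simpa using h0
  obtain ⟨y, hy, hmax⟩ := Finset.exists_max_image _ cs.length hs
  have h1 : (basis cs φ).repr (bar cs φ h) y = barCoeff Γ ((basis cs φ).repr h y) := by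
    change (basis cs φ).repr (Finsupp.sum _ _) y = _
    rw [Finsupp.sum, map_sum, Finsupp.finsetSum_apply, Finset.sum_eq_single y]
    · rw [← bar_T, ← sub_add_cancel (bar cs φ (T cs φ y)) (T cs φ y), smul_add, map_add,
        Finsupp.add_apply, map_smul, map_smul, Finsupp.smul_apply, Finsupp.smul_apply,
        bar_T_sub_mem_low y y le_rfl, repr_T]
      simp
    · intro x hx hxy
      rw [← bar_T, ← sub_add_cancel (bar cs φ (T cs φ x)) (T cs φ x), smul_add, map_add,
        Finsupp.add_apply, map_smul, map_smul, Finsupp.smul_apply, Finsupp.smul_apply,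
        bar_T_sub_mem_low x y (hmax x hx), repr_T]
      simp [hxy]
    · intro hy'
      exact absurd hy hy'
  rw [hb] at h1
  exact Finsupp.mem_support_iff.1 hy (eq_zero_of_bar_invariant_of_neg h1.symm (hn y))

theorem IsKL.unique {w : W} {C C' : HeckeAlgebra cs φ} (h : IsKL w C) (h' : IsKL w C') :
    C = C' := by
  rw [← sub_eq_zero]
  refine eq_zero_of_bar_eq_of_mem_negPart (by rw [map_sub, h.1, h'.1]) ?_
  simpa using sub_mem h.2 h'.2

theorem exists_correction (w : W) (n : ℕ)
    (ih : ∀ y, cs.length y < n →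
      ∃ C : HeckeAlgebra cs φ, IsKL y C ∧ C - T cs φ y ∈ low cs φ (cs.length y))
    (h : HeckeAlgebra cs φ) (hb : bar cs φ h = h) (hl : h - T cs φ w ∈ low cs φ n) :
    ∃ C : HeckeAlgebra cs φ, IsKL w C ∧ C - T cs φ w ∈ low cs φ n := by
  classical
  choose! C hC hClow using ih
  choose s hs hsn using exists_bar_invariant_approx (Γ := Γ)
  have step : ∀ j ≤ n, ∃ g : HeckeAlgebra cs φ, bar cs φ g = g ∧ g - T cs φ w ∈ low cs φ n ∧
      ∀ y, n ≤ cs.length y + j → (basis cs φ).repr (g - T cs φ w) y ∈ negCoeff Γ := by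
    intro j
    induction j with
    | zero =>
      intro _
      refine ⟨h, hb, hl, fun y hy => ?_⟩
      rw [hl y (by simpa using hy)]
      exact zero_mem _
    | succ j ihj =>
      intro hj
      obtain ⟨g, hg, hgl, hgn⟩ := ihj (by omega)
      set a := (basis cs φ).repr (g - T cs φ w) with ha
      set F := a.support.filter (fun y => cs.length y + j + 1 = n) with hF
      set D := ∑ y ∈ F, s (a y) • C y with hD
      have hFn : ∀ y ∈ F, cs.length y + j + 1 = n := fun y hy => (Finset.mem_filter.1 hy).2
      have hDb : bar cs φ D = D := by
        rw [hD, map_sum]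
        refine Finset.sum_congr rfl fun y hy => ?_
        rw [LinearMap.map_smulₛₗ, hs, (hC y (by have := hFn y hy; omega)).1]
      have hDr : ∀ y, n ≤ cs.length y + (j + 1) →
          (basis cs φ).repr D y = if y ∈ F then s (a y) else 0 := by
        intro y hy
        rw [hD, map_sum, Finsupp.finsetSum_apply, ← Finset.sum_ite_eq' F y (fun y => s (a y))]
        refine Finset.sum_congr rfl fun x hx => ?_
        have hxn := hFn x hx
        rw [← sub_add_cancel (C x) (T cs φ x), smul_add, map_add, Finsupp.add_apply, map_smul,
          map_smul, Finsupp.smul_apply, Finsupp.smul_apply,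
          hClow x (by omega) y (by omega), repr_T]
        simp
      have hDl : D ∈ low cs φ n := by
        refine Submodule.sum_mem _ fun x hx => Submodule.smul_mem _ _ ?_
        have hxn := hFn x hx
        rw [← sub_add_cancel (C x) (T cs φ x)]
        exact Submodule.add_mem _ (low_mono (by omega) (hClow x (by omega)))
          (T_mem_low (by omega))
      refine ⟨g - D, by rw [map_sub, hg, hDb], ?_, fun y hy => ?_⟩
      · rw [sub_right_comm]
        exact Submodule.sub_mem _ hgl hDl
      · rw [sub_right_comm, map_sub, Finsupp.sub_apply, ← ha, hDr y hy]
        by_cases hyF : y ∈ F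
        · rw [if_pos hyF]
          exact hsn _
        · rw [if_neg hyF, sub_zero]
          by_cases hyn : cs.length y + j + 1 = n
          · have : a y = 0 := by
              by_contra h0
              exact hyF (Finset.mem_filter.2 ⟨Finsupp.mem_support_iff.2 h0, hyn⟩)
            rw [this]; exact zero_mem _
          · exact hgn y (by omega)
  obtain ⟨g, hg, hgl, hgn⟩ := step n le_rfl
  exact ⟨g, ⟨hg, fun y => hgn y (by omega)⟩, hgl⟩

theorem exists_isKL (w : W) : ∃ C : HeckeAlgebra cs φ,
    IsKL w C ∧ C - T cs φ w ∈ low cs φ (cs.length w) := by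
  induction hn : cs.length w using Nat.strong_induction_on generalizing w with
  | _ n ih =>
    subst hn
    have ih' : ∀ y, cs.length y < cs.length w →
      ∃ C : HeckeAlgebra cs φ, IsKL y C ∧ C - T cs φ y ∈ low cs φ (cs.length y) :=
      fun y hy => ih _ hy y rfl
    by_cases hw : w = 1
    · subst hw
      refine exists_correction 1 _ ih' 1 bar_one ?_
      rw [← one_def, sub_self]; exact Submodule.zero_mem _
    · obtain ⟨i, hi⟩ := cs.exists_leftDescent_of_ne_one hw
      obtain ⟨C, hC, hCl⟩ := ih' (cs.simple i * w) hi
      have hd : ¬ cs.IsLeftDescent (cs.simple i * w) i :=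
        cs.isLeftDescent_iff_not_isLeftDescent_mul.1 hi
      have hlen := cs.isLeftDescent_iff.1 hi
      set c : AddMonoidAlgebra ℤ Γ := AddMonoidAlgebra.single (-φ (cs.toSBar i)) 1 with hc
      refine exists_correction w _ ih' (T cs φ (cs.simple i) * C + c • C) ?_ ?_
      · rw [map_add, bar_T_simple_mul, LinearMap.map_smulₛₗ, hC.1, sub_mul, ← Algebra.smul_def,
          sub_add, ← sub_smul, hc, barCoeff_single, neg_neg, xi, sub_sub_cancel_left, neg_smul,
          sub_neg_eq_add]
      · have hCm : C ∈ low cs φ (cs.length w) := by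
          rw [← sub_add_cancel C (T cs φ (cs.simple i * w))]
          exact Submodule.add_mem _ (low_mono (by omega) hCl) (T_mem_low (by omega))
        have e : T cs φ (cs.simple i) * C + c • C - T cs φ w =
            T cs φ (cs.simple i) * (C - T cs φ (cs.simple i * w)) + c • C := by
          rw [mul_sub, T_simple_mul_of_not_descent hd, simple_mul_simple_cancel_left]; abel
        rw [e]
        have h1 := T_simple_mul_mem_low i hCl
        rw [hlen] at h1
        exact Submodule.add_mem _ h1 (Submodule.smul_mem _ _ hCm)

theorem existsUnique_isKL (w : W) : ∃! C : HeckeAlgebra cs φ, IsKL w C := by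
  obtain ⟨C, hC, -⟩ := exists_isKL (φ := φ) w
  exact ⟨C, hC, fun _ h => h.unique hC⟩

variable (cs φ) in
/-- The Kazhdan-Lusztig element `C_w`. -/
def klElement (w : W) : HeckeAlgebra cs φ := (existsUnique_isKL w).choose

theorem klElement_isKL (w : W) : IsKL w (klElement cs φ w) :=
  (existsUnique_isKL w).choose_spec.1

theorem klElement_sub_mem_low (w : W) :
    klElement cs φ w - T cs φ w ∈ low cs φ (cs.length w) := by
  obtain ⟨C, hC, hl⟩ := exists_isKL (φ := φ) w
  rwa [(klElement_isKL w).unique hC]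

theorem repr_klElement [DecidableEq W] {w y : W} (h : cs.length w ≤ cs.length y) :
    (basis cs φ).repr (klElement cs φ w) y = if w = y then 1 else 0 := by
  rw [← sub_add_cancel (klElement cs φ w) (T cs φ w), map_add, Finsupp.add_apply,
    klElement_sub_mem_low w y h, repr_T, zero_add]

theorem klElement_linearIndependent :
    LinearIndependent (AddMonoidAlgebra ℤ Γ) (klElement cs φ) := by
  classical
  rw [linearIndependent_iff]
  intro c hc
  by_contra h0
  obtain ⟨y, hy, hmax⟩ := Finset.exists_max_image _ cs.length (Finsupp.support_nonempty_iff.2 h0)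
  have h1 := DFunLike.congr_fun (congrArg (basis cs φ).repr hc) y
  rw [Finsupp.linearCombination_apply, Finsupp.sum, map_sum, Finsupp.finsetSum_apply,
    Finset.sum_eq_single y] at h1
  · rw [map_smul, Finsupp.smul_apply, repr_klElement le_rfl] at h1
    exact Finsupp.mem_support_iff.1 hy (by simpa using h1)
  · intro x hx hxy
    rw [map_smul, Finsupp.smul_apply, repr_klElement (hmax x hx), if_neg hxy, smul_zero]
  · intro hy'
    exact absurd hy hy'

theorem klElement_span :
    ⊤ ≤ Submodule.span (AddMonoidAlgebra ℤ Γ) (Set.range (klElement cs φ)) := by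
  have key : ∀ n, ∀ w, cs.length w = n →
      T cs φ w ∈ Submodule.span (AddMonoidAlgebra ℤ Γ) (Set.range (klElement cs φ)) := by
    intro n
    induction n using Nat.strong_induction_on with
    | _ n ih =>
      rintro w rfl
      rw [← sub_sub_cancel (klElement cs φ w) (T cs φ w)]
      refine Submodule.sub_mem _ (Submodule.subset_span ⟨w, rfl⟩) ?_
      exact mem_of_T_mem (klElement_sub_mem_low w) LinearMap.id fun y hy => ih _ hy y rfl
  rw [← (basis cs φ).span_eq, Submodule.span_le]
  rintro _ ⟨w, rfl⟩
  exact key _ w rfl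

variable (cs φ) in
/-- The Kazhdan-Lusztig basis `(C_w)`. -/
def klBasis : Module.Basis W (AddMonoidAlgebra ℤ Γ) (HeckeAlgebra cs φ) :=
  Module.Basis.mk klElement_linearIndependent klElement_span

theorem klBasis_apply (w : W) : klBasis cs φ w = klElement cs φ w := by
  simp [klBasis]

end

end HeckeAlgebra

end CoxeterSystem

/-! ### Positive subsets of an abelian group -/

/-- A positive subset `X` of an abelian group `Λ`: `Λ = X ∪ (-X)`, `X + X ⊆ X`, and
`X ∩ (-X)` is a subgroup. -/
@[ext]
structure PositiveSubset (Λ : Type*) [AddCommGroup Λ] where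
  /-- The underlying set. -/
  carrier : Set Λ
  mem_or_neg_mem : ∀ a, a ∈ carrier ∨ -a ∈ carrier
  add_mem : ∀ a b, a ∈ carrier → b ∈ carrier → a + b ∈ carrier
  inter_neg_isSubgroup : ∃ K : AddSubgroup Λ, ∀ a, a ∈ K ↔ a ∈ carrier ∧ -a ∈ carrier

namespace PositiveSubset

noncomputable section

variable {Λ : Type*} [AddCommGroup Λ]

/-- The subgroup `X ∩ (-X)`. -/
def kernel (X : PositiveSubset Λ) : AddSubgroup Λ where
  carrier := {a | a ∈ X.carrier ∧ -a ∈ X.carrier}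
  add_mem' {a b} ha hb :=
    ⟨X.add_mem _ _ ha.1 hb.1, by rw [neg_add]; exact X.add_mem _ _ ha.2 hb.2⟩
  zero_mem' := by
    have h : (0 : Λ) ∈ X.carrier := by simpa using X.mem_or_neg_mem 0
    exact ⟨h, by simpa using h⟩
  neg_mem' {a} ha := ⟨ha.2, by simpa using ha.1⟩

theorem mem_kernel (X : PositiveSubset Λ) (a : Λ) :
    a ∈ X.kernel ↔ a ∈ X.carrier ∧ -a ∈ X.carrier := Iff.rfl

/-- The quotient group `Γ_X = Λ / (X ∩ (-X))`. -/
def ValueGroup (X : PositiveSubset Λ) : Type _ := Λ ⧸ X.kernel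

instance (X : PositiveSubset Λ) : AddCommGroup X.ValueGroup :=
  inferInstanceAs (AddCommGroup (Λ ⧸ X.kernel))

/-- The canonical morphism `Λ → Γ_X`. -/
def can (X : PositiveSubset Λ) : Λ →+ X.ValueGroup := QuotientAddGroup.mk' X.kernel

theorem can_surjective (X : PositiveSubset Λ) : Function.Surjective X.can :=
  QuotientAddGroup.mk'_surjective X.kernel

theorem can_eq_can_iff (X : PositiveSubset Λ) {a b : Λ} :
    X.can a = X.can b ↔ -a + b ∈ X.kernel :=
  QuotientAddGroup.eq

theorem mem_of_can_eq (X : PositiveSubset Λ) {a b : Λ} (h : X.can a = X.can b)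
    (ha : a ∈ X.carrier) : b ∈ X.carrier := by
  have := X.add_mem _ _ ha (X.can_eq_can_iff.1 h).1
  simpa using this

/-- `γ ≤ γ'` when some representative of `γ' - γ` belongs to `X`. -/
instance (X : PositiveSubset Λ) : LE X.ValueGroup :=
  ⟨fun γ γ' => ∃ a ∈ X.carrier, X.can a = γ' - γ⟩

theorem le_def (X : PositiveSubset Λ) (γ γ' : X.ValueGroup) :
    γ ≤ γ' ↔ ∃ a ∈ X.carrier, X.can a = γ' - γ := Iff.rfl

open Classical in
instance (X : PositiveSubset Λ) : LinearOrder X.ValueGroup where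
  le_refl γ := ⟨0, by simpa using X.mem_or_neg_mem 0, by simp⟩
  le_trans γ₁ γ₂ γ₃ := by
    rintro ⟨a, ha, ha'⟩ ⟨b, hb, hb'⟩
    exact ⟨a + b, X.add_mem _ _ ha hb, by rw [map_add, ha', hb']; abel⟩
  le_antisymm γ γ' := by
    rintro ⟨a, ha, ha'⟩ ⟨b, hb, hb'⟩
    have h : X.can (-a) = X.can b := by rw [map_neg, ha', hb', neg_sub]
    have hk : a ∈ X.kernel := ⟨ha, X.mem_of_can_eq h.symm hb⟩
    have h0 : X.can 0 = X.can a := X.can_eq_can_iff.2 (by simpa using hk)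
    rw [map_zero, ha'] at h0
    exact (sub_eq_zero.1 h0.symm).symm
  le_total γ γ' := by
    obtain ⟨a, ha⟩ := X.can_surjective (γ' - γ)
    rcases X.mem_or_neg_mem a with h | h
    · exact Or.inl ⟨a, h, ha⟩
    · exact Or.inr ⟨-a, h, by rw [map_neg, ha, neg_sub]⟩
  toDecidableLE := Classical.decRel _

instance (X : PositiveSubset Λ) : IsOrderedAddMonoid X.ValueGroup where
  add_le_add_left γ γ' h δ := by
    obtain ⟨a, ha, ha'⟩ := h
    exact ⟨a, ha, by rw [ha']; abel⟩

/-- The inverse image `σ^*(X) = σ⁻¹(X)` of a positive subset under a morphism. -/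
def comap {Λ' : Type*} [AddCommGroup Λ'] (σ : Λ →+ Λ') (X : PositiveSubset Λ') :
    PositiveSubset Λ where
  carrier := σ ⁻¹' X.carrier
  mem_or_neg_mem a := by simpa using X.mem_or_neg_mem (σ a)
  add_mem a b ha hb := by simpa using X.add_mem _ _ ha hb
  inter_neg_isSubgroup := ⟨X.kernel.comap σ, fun a => by simp [mem_kernel]⟩

end

end PositiveSubset

/-! ### Cells -/

/-- The three kinds of cells: left, right, two-sided. -/
inductive CellKind
  | L
  | R
  | LR

namespace CoxeterSystem

noncomputable section

open HeckeAlgebra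

variable {B W Γ : Type*} [Group W] {M : CoxeterMatrix B} (cs : CoxeterSystem M W)

section

variable [AddCommGroup Γ] [LinearOrder Γ] [IsOrderedAddMonoid Γ]

/-- The elementary relation `x ← y`: the element `C_x` occurs in `h C_y` (kind `L`), in `C_y h`
(kind `R`), or in one of them (kind `LR`), for some `h` in the Hecke algebra. -/
def cellStep (φ : cs.SBar → Γ) : CellKind → W → W → Prop
  | .L, x, y => ∃ h : HeckeAlgebra cs φ, (klBasis cs φ).repr (h * klElement cs φ y) x ≠ 0
  | .R, x, y => ∃ h : HeckeAlgebra cs φ, (klBasis cs φ).repr (klElement cs φ y * h) x ≠ 0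
  | .LR, x, y => ∃ h : HeckeAlgebra cs φ, (klBasis cs φ).repr (h * klElement cs φ y) x ≠ 0 ∨
      (klBasis cs φ).repr (klElement cs φ y * h) x ≠ 0

/-- The preorder `≤_?^φ`: the transitive closure of `x ← y`. -/
def cellLE (φ : cs.SBar → Γ) (k : CellKind) : W → W → Prop :=
  Relation.TransGen (cs.cellStep φ k)

/-- The equivalence relation `∼_?^φ`, whose classes are the cells. -/
def cellEquiv (φ : cs.SBar → Γ) (k : CellKind) (x y : W) : Prop :=
  cs.cellLE φ k x y ∧ cs.cellLE φ k y x

end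

/-- The canonical map `φ_X : S̄ → Γ_X` attached to a positive subset `X` of `ℤ[S̄]`. -/
def phiPos (X : PositiveSubset (cs.SBar →₀ ℤ)) : cs.SBar → X.ValueGroup :=
  fun η => X.can (Finsupp.single η 1)

/-- The relation `∼_?^X` attached to a positive subset `X` of `ℤ[S̄]`. -/
def cellEquivPos (X : PositiveSubset (cs.SBar →₀ ℤ)) (k : CellKind) : W → W → Prop :=
  cs.cellEquiv (cs.phiPos X) k

open Classical in
/-- The symmetry `τ_ω` of `ℤ[S̄]`: `ω ↦ -ω`, and `η ↦ η` for `η ≠ ω`. -/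
def tau (ω : cs.SBar) : (cs.SBar →₀ ℤ) →ₗ[ℤ] (cs.SBar →₀ ℤ) :=
  Finsupp.linearCombination ℤ fun η =>
    if η = ω then -Finsupp.single ω 1 else Finsupp.single η 1

/-- The induced map `τ_ω^*` on positive subsets. -/
def tauStar (ω : cs.SBar) (X : PositiveSubset (cs.SBar →₀ ℤ)) :
    PositiveSubset (cs.SBar →₀ ℤ) :=
  X.comap (cs.tau ω).toAddMonoidHom

end

end CoxeterSystem

/-! The weights of `τ_ω^*(X)` become those of `X`, up to a sign on the class `ω`, under the strictly
increasing morphism `Γ_{τ_ω^*(X)} → Γ_X` induced by `τ_ω`. Simple reflections joined by an odd bond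
are conjugate, so signs on the conjugacy classes extend to a linear character `ε` of `W`. As
`e^γ - e^{-γ}` is odd in `γ`, the semilinear map `T_w ↦ ε(w) T_w` respects the quadratic relations
of the two Hecke algebras, hence is multiplicative and commutes with the bar involutions. It is
compatible with the orders on the weights, so it sends `C_w` to `ε(w) C_w`: the structure constants
of the two Kazhdan-Lusztig bases agree up to signs and an injective change of scalars. -/

noncomputable section

open CoxeterSystem HeckeAlgebra

theorem map_intUnits_smul {F A A' : Type*} [AddCommGroup A] [AddCommGroup A'] [FunLike F A A']
    [AddMonoidHomClass F A A'] (f : F) (u : ℤˣ) (a : A) : f (u • a) = u • f a := by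
  rw [Units.smul_def, map_zsmul, Units.smul_def]

section Basis

variable {ι R R' M M' : Type*} [Ring R] [Ring R'] [AddCommGroup M] [AddCommGroup M']
  [Module R M] [Module R' M'] {g : R →+* R'}

theorem basis_repr_apply_of_apply_eq_units_smul (b : Module.Basis ι R M)
    (b' : Module.Basis ι R' M') {F : M →ₛₗ[g] M'} {u : ι → ℤˣ} (hF : ∀ i, F (b i) = u i • b' i)
    (m : M) (i : ι) : b'.repr (F m) i = u i • g (b.repr m i) := by
  classical
  suffices h : ∀ c : ι →₀ R, b'.repr (F (b.repr.symm c)) i = u i • g (c i) by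
    simpa only [LinearEquiv.symm_apply_apply] using h (b.repr m)
  intro c
  induction c using Finsupp.induction_linear with
  | zero => simp
  | add c d hc hd => simp only [map_add, Finsupp.add_apply, hc, hd, smul_add]
  | single j r =>
    rw [b.repr_symm_single, LinearMap.map_smulₛₗ, hF, map_smul, map_intUnits_smul]
    by_cases hij : j = i <;> simp [hij]

theorem exists_apply_ne_zero_iff_exists_basis (b : Module.Basis ι R M) (f : M →ₛₗ[g] M') :
    (∃ m, f m ≠ 0) ↔ ∃ i, f (b i) ≠ 0 := by
  refine ⟨fun ⟨m, hm⟩ => ?_, fun ⟨i, hi⟩ => ⟨b i, hi⟩⟩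
  contrapose! hm
  rw [b.ext (f₂ := 0) hm, LinearMap.zero_apply]

end Basis

section GroupRing

variable {Γ Γ' : Type*} [AddCommGroup Γ] [AddCommGroup Γ'] (f : Γ →+ Γ')

/-- The morphism of group rings `e^γ ↦ e^{f(γ)}`. -/
def groupRingMap : AddMonoidAlgebra ℤ Γ →+* AddMonoidAlgebra ℤ Γ' :=
  AddMonoidAlgebra.mapDomainRingHom ℤ f

theorem groupRingMap_single (γ : Γ) (n : ℤ) :
    groupRingMap f (AddMonoidAlgebra.single γ n) = AddMonoidAlgebra.single (f γ) n := by
  simp [groupRingMap]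

theorem groupRingMap_barCoeff (a : AddMonoidAlgebra ℤ Γ) :
    groupRingMap f (barCoeff Γ a) = barCoeff Γ' (groupRingMap f a) := by
  induction a using AddMonoidAlgebra.induction_linear with
  | zero => simp
  | add a b ha hb => simp [ha, hb]
  | single γ n => simp [barCoeff_single, groupRingMap_single]

theorem groupRingMap_injective (hf : Function.Injective f) :
    Function.Injective (groupRingMap f) :=
  AddMonoidAlgebra.mapDomain_injective hf

theorem groupRingMap_mem_negCoeff [LinearOrder Γ] [LinearOrder Γ'] (hf : StrictMono f)
    {a : AddMonoidAlgebra ℤ Γ} (ha : a ∈ negCoeff Γ) : groupRingMap f a ∈ negCoeff Γ' := by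
  classical
  intro γ' hγ'
  obtain ⟨γ, hγ, rfl⟩ := Finset.mem_image.1
    (Finsupp.mapDomain_support (f := f) (s := a.coeff) (Finsupp.mem_support_iff.2 hγ'))
  rw [← map_zero f]
  exact hf (ha γ (Finsupp.mem_support_iff.1 hγ))

end GroupRing

section SignCharacter

theorem isConj_of_odd_pow_mul_eq_one {G : Type*} [Group G] {a b : G} {n : ℕ} (ha : a * a = 1)
    (hb : b * b = 1) (hn : Odd n) (hab : (a * b) ^ n = 1) : IsConj a b := by
  obtain ⟨k, rfl⟩ := hn
  have b_inv : b⁻¹ = b := inv_eq_of_mul_eq_one_left hb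
  have semiconj : SemiconjBy a (a * b) (a * b)⁻¹ := by
    rw [SemiconjBy, mul_inv_rev, inv_mul_cancel_right, b_inv, ← mul_assoc, ha, one_mul]
  have semiconj_pow : (a * b) ^ k * a = a * ((a * b) ^ k)⁻¹ := by
    simpa only [inv_pow, inv_inv] using (semiconj.pow_right k).inv_right.eq.symm
  have pow_mul_pow : (a * b) ^ k * (a * b) ^ k = (a * b)⁻¹ :=
    eq_inv_of_mul_eq_one_left (by rw [← pow_add, ← pow_succ, ← two_mul, hab])
  refine isConj_iff.2 ⟨(a * b) ^ k, ?_⟩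
  rw [semiconj_pow, mul_assoc, ← mul_inv_rev, pow_mul_pow, inv_inv, ← mul_assoc, ha, one_mul]

variable {B W : Type*} [Group W] {M : CoxeterMatrix B} {cs : CoxeterSystem M W}

theorem toSBar_eq_of_odd {i j : B} (h : Odd (M i j)) : cs.toSBar i = cs.toSBar j :=
  Quotient.sound (s := cs.simpleConj) <|
    isConj_of_odd_pow_mul_eq_one (cs.simple_mul_simple_self i) (cs.simple_mul_simple_self j) h
      (cs.simple_mul_simple_pow i j)

theorem isLiftable_sign (σ : cs.SBar → ℤˣ) : M.IsLiftable fun i => σ (cs.toSBar i) := by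
  intro i j
  rcases Nat.even_or_odd (M i j) with ⟨k, hk⟩ | h
  · rw [hk, ← two_mul, pow_mul, Int.units_sq, one_pow]
  · simp only [toSBar_eq_of_odd h, Int.units_mul_self, one_pow]

/-- The linear character of `W` with prescribed signs on the classes of simple reflections. -/
def signChar (σ : cs.SBar → ℤˣ) : W →* ℤˣ :=
  cs.lift ⟨_, isLiftable_sign σ⟩

theorem signChar_simple (σ : cs.SBar → ℤˣ) (i : B) :
    signChar σ (cs.simple i) = σ (cs.toSBar i) := by
  simp [signChar]

end SignCharacter

section Hecke

variable {B W Γ : Type*} [Group W] {M : CoxeterMatrix B} {cs : CoxeterSystem M W}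
  [AddCommGroup Γ] {φ : cs.SBar → Γ}

theorem hecke_induction_T {p : HeckeAlgebra cs φ → Prop} (T_mem : ∀ w, p (T cs φ w))
    (add : ∀ a b, p a → p b → p (a + b))
    (smul : ∀ (r : AddMonoidAlgebra ℤ Γ) (a), p a → p (r • a)) (h : HeckeAlgebra cs φ) : p h := by
  induction (basis cs φ).mem_span h using Submodule.span_induction with
  | mem _ hT => obtain ⟨w, rfl⟩ := hT; exact T_mem w
  | zero => simpa using smul 0 _ (T_mem 1)
  | add a b _ _ ha hb => exact add a b ha hb
  | smul r a _ ha => exact smul r a ha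

theorem hecke_induction_simple_mul {p : HeckeAlgebra cs φ → Prop} (one : p 1)
    (simple_mul : ∀ (i : B) (a), p a → p (T cs φ (cs.simple i) * a))
    (add : ∀ a b, p a → p b → p (a + b))
    (smul : ∀ (r : AddMonoidAlgebra ℤ Γ) (a), p a → p (r • a)) (h : HeckeAlgebra cs φ) : p h := by
  refine hecke_induction_T (fun w => ?_) add smul h
  obtain ⟨l, hl, rfl⟩ := cs.exists_isReduced w
  induction l with
  | nil => rwa [wordProd_nil, ← one_def]
  | cons i l ih =>
    have hl' : cs.IsReduced l := by simpa using hl.drop 1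
    have not_descent : ¬ cs.IsLeftDescent (cs.wordProd l) i := by
      rw [IsLeftDescent, ← wordProd_cons, hl.eq, hl'.eq, List.length_cons]
      omega
    rw [wordProd_cons, ← T_simple_mul_of_not_descent not_descent]
    exact simple_mul i _ (ih hl')

end Hecke

/-- A morphism of weight groups carrying the weight function `φ` to `φ'` up to a sign on each
conjugacy class of simple reflections. -/
structure SignedWeightHom {B W Γ Γ' : Type*} [Group W] {M : CoxeterMatrix B}
    {cs : CoxeterSystem M W} [AddCommGroup Γ] [AddCommGroup Γ'] (φ : cs.SBar → Γ)
    (φ' : cs.SBar → Γ') extends Γ →+ Γ' where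
  sign : cs.SBar → ℤˣ
  map_weight : ∀ η, toAddMonoidHom (φ η) = sign η • φ' η

namespace SignedWeightHom

variable {B W Γ Γ' : Type*} [Group W] {M : CoxeterMatrix B} {cs : CoxeterSystem M W}
  [AddCommGroup Γ] [AddCommGroup Γ'] {φ : cs.SBar → Γ} {φ' : cs.SBar → Γ'}
  (e : SignedWeightHom φ φ')

theorem groupRingMap_xi (i : B) :
    groupRingMap e.toAddMonoidHom (xi cs φ i) = e.sign (cs.toSBar i) • xi cs φ' i := by
  rw [xi, xi, map_sub, groupRingMap_single, groupRingMap_single, map_neg, e.map_weight]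
  rcases Int.units_eq_one_or (e.sign (cs.toSBar i)) with h | h <;> simp [h]

/-- The semilinear map `T_w ↦ ε(w) T_w` between Hecke algebras, where `ε` is the linear character
attached to the signs of `e`. -/
def twist : HeckeAlgebra cs φ →ₛₗ[groupRingMap e.toAddMonoidHom] HeckeAlgebra cs φ' :=
  Finsupp.linearCombination _ (fun w => signChar e.sign w • T cs φ' w) ∘ₛₗ
    Finsupp.mapRange.linearMap (groupRingMap e.toAddMonoidHom).toSemilinearMap ∘ₛₗ
      (basis cs φ).repr.toLinearMap

theorem twist_T (w : W) : e.twist (T cs φ w) = signChar e.sign w • T cs φ' w := by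
  simp [twist, T]

theorem twist_T_simple (i : B) :
    e.twist (T cs φ (cs.simple i)) = e.sign (cs.toSBar i) • T cs φ' (cs.simple i) := by
  rw [twist_T, signChar_simple]

theorem twist_one : e.twist 1 = 1 := by
  rw [one_def, twist_T, map_one, one_smul, one_def]

theorem repr_twist (h : HeckeAlgebra cs φ) (w : W) :
    (basis cs φ').repr (e.twist h) w =
      signChar e.sign w • groupRingMap e.toAddMonoidHom ((basis cs φ).repr h w) :=
  basis_repr_apply_of_apply_eq_units_smul _ _ e.twist_T h w

theorem twist_T_simple_mul_T (i : B) (w : W) :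
    e.twist (T cs φ (cs.simple i) * T cs φ w) =
      e.twist (T cs φ (cs.simple i)) * e.twist (T cs φ w) := by
  have twist_T_mul_simple : e.twist (T cs φ (cs.simple i * w)) =
      (e.sign (cs.toSBar i) * signChar e.sign w) • T cs φ' (cs.simple i * w) := by
    rw [twist_T, map_mul, signChar_simple]
  rw [twist_T_simple, e.twist_T w, smul_mul_smul_comm]
  by_cases descent : cs.IsLeftDescent w i
  · rw [T_simple_mul_of_descent descent, T_simple_mul_of_descent descent, map_add,
      LinearMap.map_smulₛₗ, groupRingMap_xi, twist_T_mul_simple, twist_T, smul_add,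
      smul_smul_smul_comm, smul_eq_mul]
  · rw [T_simple_mul_of_not_descent descent, T_simple_mul_of_not_descent descent,
      twist_T_mul_simple]

theorem twist_T_simple_mul (i : B) (h : HeckeAlgebra cs φ) :
    e.twist (T cs φ (cs.simple i) * h) = e.twist (T cs φ (cs.simple i)) * e.twist h := by
  induction h using hecke_induction_T with
  | T_mem w => exact e.twist_T_simple_mul_T i w
  | add a b ha hb => simp only [mul_add, map_add, ha, hb]
  | smul r a ha => simp only [mul_smul_comm, LinearMap.map_smulₛₗ, ha]

theorem twist_mul (a b : HeckeAlgebra cs φ) : e.twist (a * b) = e.twist a * e.twist b := by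
  induction a using hecke_induction_simple_mul with
  | one => rw [twist_one, one_mul, one_mul]
  | simple_mul i a ha => rw [mul_assoc, twist_T_simple_mul, ha, twist_T_simple_mul, mul_assoc]
  | add a c ha hc => simp only [add_mul, map_add, ha, hc]
  | smul r a ha => simp only [smul_mul_assoc, LinearMap.map_smulₛₗ, ha]

theorem twist_T_simple_sub_xi (i : B) :
    e.twist (T cs φ (cs.simple i) - algebraMap _ _ (xi cs φ i)) =
      e.sign (cs.toSBar i) • (T cs φ' (cs.simple i) - algebraMap _ _ (xi cs φ' i)) := by
  rw [map_sub, twist_T_simple, Algebra.algebraMap_eq_smul_one, LinearMap.map_smulₛₗ, twist_one,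
    groupRingMap_xi, smul_assoc, ← smul_sub, Algebra.algebraMap_eq_smul_one]

theorem twist_bar (h : HeckeAlgebra cs φ) : e.twist (bar cs φ h) = bar cs φ' (e.twist h) := by
  induction h using hecke_induction_simple_mul with
  | one => rw [bar_one, twist_one, bar_one]
  | simple_mul i a ha =>
    rw [bar_T_simple_mul, twist_mul, twist_T_simple_sub_xi, ha, twist_mul, twist_T_simple,
      smul_mul_assoc, smul_mul_assoc, map_intUnits_smul, bar_T_simple_mul]
  | add a b ha hb => simp only [map_add, ha, hb]
  | smul r a ha => simp only [LinearMap.map_smulₛₗ, groupRingMap_barCoeff, ha]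

section Order

variable [LinearOrder Γ] [LinearOrder Γ']

theorem twist_mem_negPart (he : StrictMono e.toAddMonoidHom) {h : HeckeAlgebra cs φ}
    (hh : h ∈ negPart cs φ) : e.twist h ∈ negPart cs φ' := by
  intro w
  rw [repr_twist]
  exact zsmul_mem (groupRingMap_mem_negCoeff _ he (hh w)) _

variable [IsOrderedAddMonoid Γ] [IsOrderedAddMonoid Γ']

theorem twist_klElement (he : StrictMono e.toAddMonoidHom) (w : W) :
    e.twist (klElement cs φ w) = signChar e.sign w • klElement cs φ' w := by
  obtain ⟨bar_invariant, sub_mem⟩ := klElement_isKL (φ := φ) w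
  have isKL : IsKL w (signChar e.sign w • e.twist (klElement cs φ w)) := by
    refine ⟨by rw [map_intUnits_smul, ← twist_bar, bar_invariant], ?_⟩
    have h := zsmul_mem (e.twist_mem_negPart he sub_mem) (signChar e.sign w)
    rwa [← Units.smul_def, map_sub, twist_T, smul_sub, smul_smul, Int.units_mul_self,
      one_smul] at h
  rw [(klElement_isKL w).unique isKL, smul_smul, Int.units_mul_self, one_smul]

theorem klBasis_repr_twist (he : StrictMono e.toAddMonoidHom) (h : HeckeAlgebra cs φ) (x : W) :
    (klBasis cs φ').repr (e.twist h) x =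
      signChar e.sign x • groupRingMap e.toAddMonoidHom ((klBasis cs φ).repr h x) :=
  basis_repr_apply_of_apply_eq_units_smul _ _
    (fun w => by simpa only [klBasis_apply] using e.twist_klElement he w) h x

theorem klBasis_repr_ne_zero_iff (he : StrictMono e.toAddMonoidHom) {h : HeckeAlgebra cs φ}
    {h' : HeckeAlgebra cs φ'} {u : ℤˣ} (hh' : e.twist h = u • h') (x : W) :
    (klBasis cs φ').repr h' x ≠ 0 ↔ (klBasis cs φ).repr h x ≠ 0 := by
  rw [← smul_ne_zero_iff_ne u, ← Finsupp.smul_apply, ← map_intUnits_smul, ← hh',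
    klBasis_repr_twist e he, smul_ne_zero_iff_ne,
    map_ne_zero_iff _ (groupRingMap_injective _ he.injective)]

end Order

end SignedWeightHom

section Cells

variable {B W Γ Γ' : Type*} [Group W] {M : CoxeterMatrix B} {cs : CoxeterSystem M W}
  [AddCommGroup Γ] [LinearOrder Γ] [IsOrderedAddMonoid Γ]
  [AddCommGroup Γ'] [LinearOrder Γ'] [IsOrderedAddMonoid Γ']
  {φ : cs.SBar → Γ} {φ' : cs.SBar → Γ'}

theorem cellStep_L_iff_exists_T {x y : W} : cs.cellStep φ .L x y ↔
    ∃ w, (klBasis cs φ).repr (T cs φ w * klElement cs φ y) x ≠ 0 :=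
  exists_apply_ne_zero_iff_exists_basis (basis cs φ)
    ((klBasis cs φ).coord x ∘ₗ LinearMap.mulRight _ (klElement cs φ y))

theorem cellStep_R_iff_exists_T {x y : W} : cs.cellStep φ .R x y ↔
    ∃ w, (klBasis cs φ).repr (klElement cs φ y * T cs φ w) x ≠ 0 :=
  exists_apply_ne_zero_iff_exists_basis (basis cs φ)
    ((klBasis cs φ).coord x ∘ₗ LinearMap.mulLeft _ (klElement cs φ y))

theorem cellStep_LR_iff {x y : W} :
    cs.cellStep φ .LR x y ↔ cs.cellStep φ .L x y ∨ cs.cellStep φ .R x y :=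
  exists_or

namespace SignedWeightHom

variable (e : SignedWeightHom φ φ')

theorem cellStep_L_iff (he : StrictMono e.toAddMonoidHom) {x y : W} :
    cs.cellStep φ' .L x y ↔ cs.cellStep φ .L x y := by
  rw [cellStep_L_iff_exists_T, cellStep_L_iff_exists_T]
  refine exists_congr fun w => e.klBasis_repr_ne_zero_iff he
    (u := signChar e.sign w * signChar e.sign y) ?_ x
  rw [twist_mul, twist_T, twist_klElement e he, smul_mul_smul_comm]

theorem cellStep_R_iff (he : StrictMono e.toAddMonoidHom) {x y : W} :
    cs.cellStep φ' .R x y ↔ cs.cellStep φ .R x y := by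
  rw [cellStep_R_iff_exists_T, cellStep_R_iff_exists_T]
  refine exists_congr fun w => e.klBasis_repr_ne_zero_iff he
    (u := signChar e.sign y * signChar e.sign w) ?_ x
  rw [twist_mul, twist_T, twist_klElement e he, smul_mul_smul_comm]

theorem cellStep_iff (he : StrictMono e.toAddMonoidHom) (k : CellKind) {x y : W} :
    cs.cellStep φ' k x y ↔ cs.cellStep φ k x y :=
  match k with
  | .L => e.cellStep_L_iff he
  | .R => e.cellStep_R_iff he
  | .LR => by rw [cellStep_LR_iff, cellStep_LR_iff, e.cellStep_L_iff he, e.cellStep_R_iff he]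

theorem cellEquiv_eq (he : StrictMono e.toAddMonoidHom) (k : CellKind) :
    cs.cellEquiv φ' k = cs.cellEquiv φ k := by
  have cellStep_eq : cs.cellStep φ' k = cs.cellStep φ k :=
    funext₂ fun _ _ => propext (e.cellStep_iff he k)
  simp only [funext_iff, cellEquiv, cellLE, cellStep_eq, implies_true]

end SignedWeightHom

end Cells

namespace PositiveSubset

variable {Λ Λ' : Type*} [AddCommGroup Λ] [AddCommGroup Λ']

theorem can_eq_zero_iff (X : PositiveSubset Λ) {a : Λ} : X.can a = 0 ↔ a ∈ X.kernel :=
  QuotientAddGroup.eq_zero_iff a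

variable (τ : Λ →+ Λ') (X : PositiveSubset Λ')

theorem kernel_comap : (X.comap τ).kernel = X.kernel.comap τ := by
  ext a
  simp [mem_kernel, comap]

/-- The morphism `Γ_{τ^*(X)} → Γ_X` induced by `τ`. -/
def comapHom : (X.comap τ).ValueGroup →+ X.ValueGroup :=
  QuotientAddGroup.map _ _ τ (kernel_comap τ X).le

theorem comapHom_can (a : Λ) : comapHom τ X ((X.comap τ).can a) = X.can (τ a) := rfl

theorem comapHom_injective : Function.Injective (comapHom τ X) := by
  rw [injective_iff_map_eq_zero]
  intro γ h
  obtain ⟨a, rfl⟩ := (X.comap τ).can_surjective γ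
  rwa [comapHom_can, can_eq_zero_iff, ← AddSubgroup.mem_comap, ← kernel_comap,
    ← can_eq_zero_iff] at h

theorem comapHom_monotone : Monotone (comapHom τ X) := by
  rintro γ γ' ⟨a, ha, h⟩
  exact ⟨τ a, ha, by rw [← comapHom_can, h, map_sub]⟩

theorem comapHom_strictMono : StrictMono (comapHom τ X) :=
  (comapHom_monotone τ X).strictMono_of_injective (comapHom_injective τ X)

end PositiveSubset

section SignChange

variable {B W : Type*} [Group W] {M : CoxeterMatrix B} {cs : CoxeterSystem M W}

/-- The morphism `Γ_{τ^*(X)} → Γ_X` induced by an endomorphism `τ` of `ℤ[S̄]` that multiplies the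
basis elements by the signs `σ`. -/
def comapSignedWeightHom {σ : cs.SBar → ℤˣ} {τ : (cs.SBar →₀ ℤ) →+ (cs.SBar →₀ ℤ)}
    (hτ : ∀ η, τ (.single η 1) = σ η • .single η 1) (X : PositiveSubset (cs.SBar →₀ ℤ)) :
    SignedWeightHom (cs.phiPos (X.comap τ)) (cs.phiPos X) where
  __ := X.comapHom τ
  sign := σ
  map_weight η := (congrArg X.can (hτ η)).trans (map_intUnits_smul X.can _ _)

open Classical in
theorem tau_single (ω η : cs.SBar) : cs.tau ω (.single η 1) =
    (if η = ω then -1 else 1 : ℤˣ) • (.single η 1 : cs.SBar →₀ ℤ) := by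
  rw [tau, Finsupp.linearCombination_single, one_smul]
  split_ifs with h <;> simp [h]

end SignChange

theorem mainTheorem8_general {B W : Type*} [Group W] {M : CoxeterMatrix B}
    {cs : CoxeterSystem M W} {σ : cs.SBar → ℤˣ} {τ : (cs.SBar →₀ ℤ) →+ (cs.SBar →₀ ℤ)}
    (hτ : ∀ η, τ (.single η 1) = σ η • .single η 1) (X : PositiveSubset (cs.SBar →₀ ℤ))
    (k : CellKind) (x y : W) :
    cs.cellEquivPos X k x y ↔ cs.cellEquivPos (X.comap τ) k x y := by
  have cellEquiv_eq := (comapSignedWeightHom hτ X).cellEquiv_eq (X.comapHom_strictMono τ) k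
  rw [cellEquivPos, cellEquivPos, cellEquiv_eq]

end

theorem mainTheorem8 {B W : Type*} [Finite B] [Group W] {M : CoxeterMatrix B}
    (cs : CoxeterSystem M W) (ω : cs.SBar) (X : PositiveSubset (cs.SBar →₀ ℤ)) (k : CellKind)
    (x y : W) :
    cs.cellEquivPos X k x y ↔ cs.cellEquivPos (cs.tauStar ω X) k x y := by
  exact mainTheorem8_general (tau_single ω) X k x y
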